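/- Model. A network is a finite connected simple graph $G$ with $n$ nodes and $m$ edges, whose nodes carry arbitrary distinct identities in a range polynomial in $n$ (that is, natural numbers at most $a n^b$ for constants $a,b$), and where every node numbers its incident links arbitrarily. In the CONGEST model all nodes execute the same randomized algorithm, in synchronous rounds; initially a node is given only its own identity. In every round each node tosses private fair coins and performs some local computation, sends one message of $O(\log n)$ bits through each of its links, and receives the messages sent by its neighbors. At the end every node outputs accept or reject. The graph $G$ is $C_k$-free if it does not contain a $k$-node cycle as a (not necessarily induced) subgraph, and it is $\varepsilon$-far from $C_k$-free (sparse model) if no graph on the same nodes that is obtained from $G$ by adding and/or removing at most $\varepsilon m$ edges is $C_k$-free. Theorem. For every $k\ge 3$ there are a constant $K$ (depending only on $k$) and, for all $a,b\in\mathbb N$, a constant $\beta_{a,b}$ (depending only on $k,a,b$) such that for every $\varepsilon\in(0,1)$ there is a randomized distributed algorithm that stops after at most $K/\varepsilon$ rounds and satisfies, in every network $G$ with distinct identities: 1. if all identities are at most $a n^b$, then in every execution every message has at most $\beta_{a,b}\log_2 n$ bits; 2. if $G$ is $C_k$-free, then $\Pr[\text{every node outputs accept}]=1$; 3. if $G$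 is $\varepsilon$-far from $C_k$-free, then $\Pr[\text{at least one node outputs reject}]\ge 2/3$. In other words, there is a 1-sided error distributed property testing algorithm for $C_k$-freeness performing in $O(1/\varepsilon)$ rounds in the CONGEST model. -/

import Mathlib

open scoped ENNReal

namespace Congest

/-- A message is a finite string of bits; the empty string means that nothing is sent. -/
abbrev Message : Type := List Bool

/-- The two possible outputs of a node. -/
inductive Verdict : Type
  | accept
  | reject

/-- A network: a finite connected simple graph whose nodes carry distinct identities.
The `deg v` links incident to `v` are numbered locally, in an arbitrary way, by `port v`. -/
structure Network where
  V : Type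
  [fintypeV : Fintype V]
  [decEqV : DecidableEq V]
  graph : SimpleGraph V
  connected : graph.Connected
  id : V → ℕ
  id_injective : Function.Injective id
  deg : V → ℕ
  port : (v : V) → Fin (deg v) ≃ graph.neighborSet v

attribute [instance] Network.fintypeV Network.decEqV

namespace Network

/-- The number of nodes. -/
def n (N : Network) : ℕ := Fintype.card N.V

/-- The number of edges. -/
noncomputable def m (N : Network) : ℕ := N.graph.edgeSet.ncard

/-- The number, at the neighbor of `v` behind the link `i` of `v`, of this same link. -/
def backPort (N : Network) (v : N.V) (i : Fin (N.deg v)) : Fin (N.deg (N.port v i)) :=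
  (N.port (N.port v i)).symm ⟨v, (N.port v i).2.symm⟩

/-- The network has no `k`-node cycle as a (not necessarily induced) subgraph. -/
def CycleFree (N : Network) (k : ℕ) : Prop := (SimpleGraph.cycleGraph k).Free N.graph

/-- No graph on the same nodes that is obtained by adding and/or removing at most `ε * m` edges
is `C_k`-free. -/
def FarFromCycleFree (N : Network) (k : ℕ) (ε : ℝ) : Prop :=
  ∀ H : SimpleGraph N.V,
    ((symmDiff N.graph.edgeSet H.edgeSet).ncard : ℝ) ≤ ε * N.m →
      ¬ (SimpleGraph.cycleGraph k).Free H

end Network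

/-- A randomized synchronous algorithm, executed by all the nodes. A node starts with its identity
as its only input. In every round it tosses finitely many fair coins (how many depends on its
state) and computes, then it sends one message through each of its `d` links, then it receives the
messages sent by its neighbors. After `rounds` rounds it outputs a verdict. Local computation
is unrestricted. -/
structure Algorithm where
  State : Type
  rounds : ℕ
  start : ℕ → State
  coins : State → ℕ
  compute : (s : State) → (Fin (coins s) → Bool) → State
  send : {d : ℕ} → State → Fin d → Message
  receive : {d : ℕ} → State → (Fin d → Message) → State
  output : State → Verdict

namespace Algorithm

/-- A configuration gives the state of every node. -/
abbrev Config (A : Algorithm) (N : Network) : Type := N.V → A.State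

/-- The local computations of one round. The coins of all the nodes are jointly uniform, that is,
fair and independent. -/
noncomputable def computePhase (A : Algorithm) (N : Network) (s : A.Config N) :
    PMF (A.Config N) :=
  (PMF.uniformOfFintype ((v : N.V) → Fin (A.coins (s v)) → Bool)).map
    fun r v => A.compute (s v) (r v)

/-- The exchange of messages of one round: through its link `i`, the node `v` receives what the
neighbor behind this link has sent through it. -/
def communicate (A : Algorithm) (N : Network) (s : A.Config N) : A.Config N :=
  fun v => A.receive (s v) fun i : Fin (N.deg v) =>
    A.send (s (N.port v i)) (N.backPort v i)

/-- The random configuration after `t` rounds. -/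
noncomputable def afterRounds (A : Algorithm) (N : Network) : ℕ → PMF (A.Config N)
  | 0 => PMF.pure fun v => A.start (N.id v)
  | t + 1 => (A.afterRounds N t).bind fun s => (A.computePhase N s).map (A.communicate N)

/-- The random configuration in which the messages of the round `t + 1` are sent. -/
noncomputable def whenSending (A : Algorithm) (N : Network) (t : ℕ) : PMF (A.Config N) :=
  (A.afterRounds N t).bind (A.computePhase N)

/-- In every possible execution, every message has at most `L` bits. -/
def MessagesBoundedBy (A : Algorithm) (N : Network) (L : ℝ) : Prop :=
  ∀ t < A.rounds, ∀ s ∈ (A.whenSending N t).support, ∀ (v : N.V) (i : Fin (N.deg v)),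
    ((A.send (s v) i).length : ℝ) ≤ L

/-- The probability that every node outputs `accept`. -/
noncomputable def probAccept (A : Algorithm) (N : Network) : ℝ≥0∞ :=
  (A.afterRounds N A.rounds).toOuterMeasure {s | ∀ v, A.output (s v) = Verdict.accept}

/-- The probability that at least one node outputs `reject`. -/
noncomputable def probReject (A : Algorithm) (N : Network) : ℝ≥0∞ :=
  (A.afterRounds N A.rounds).toOuterMeasure {s | ∃ v, A.output (s v) = Verdict.reject}

end Algorithm

end Congest

/-!
The tester is based on color coding. In a phase of `k` rounds, every node draws a random color and
every link issues, at its end of color `0`, a token consisting of a random level and of the identity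
of this end. Tokens move along the colors `0, 1, …, k - 1` and back to color `0`; where several
tokens meet, one of maximal level survives, so a single message per link and round suffices. A node
that gets back its own token has found a closed walk with the colors `0, …, k - 1`, that is, a
`k`-node cycle. So the error is one-sided (`not_cycleFree_of_rejected`).

Conversely, a network that is `ε`-far from `C_k`-free has more than `ε * m` links on `k`-node
cycles, since the removal of all these links makes it `C_k`-free (`lt_ncard_goodDart`). The level of
a link is the number of heads before the first tail in a sequence of coin tosses. If `2 ^ L` is of
the order of `m`, a given link has level at least `L`, and all other links have smaller levels, with
probability of the order of `1 / m`; then its token is never discarded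
(`rejected_of_unique_level`). Together with the probability `2 ^ -(k * k)` that the colors on a
cycle are the right ones, this happens for a given link on a cycle with probability of the order of
`1 / m` (`le_ncard_winning`), and, as these events are disjoint, for some link on a cycle with
probability of the order of `ε` (`ncard_no_rejection_le`). So `O(1 / ε)` phases suffice.

The nodes know neither `n` nor `m`, but levels must be able to reach `L`, about `log m`, and must not
have more than `O(log n)` bits. Therefore, in `⌈1 / ε⌉` preliminary rounds, every node computes the
largest identity `M` within this distance, and a level is based on about `6 * log M` coins. This
fits into a message. It is not enough only for links at nodes with `M` less than about
`n ^ (1 / 3)`. As the identities are distinct, there are few such links: if `μ` is the largest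
`M + 1` at such a node, at most `μ` nodes are concerned, all of degree at most `μ`, and `μ` is at
least `1 / ε`, so that there are at most `μ ^ 2 ≤ ε * μ ^ 3` such links, which is at most
`ε * m / 2` (`ncard_poorDart_le`).
-/

namespace Congest

namespace CycleTester

/-! ### Encoding of messages -/

/-- The natural number with the given binary digits, least significant digit first. -/
def ofBits (l : List Bool) : ℕ := l.foldr Nat.bit 0

@[simp]
theorem ofBits_bits (n : ℕ) : ofBits n.bits = n := by
  induction n using Nat.binaryRec' with
  | zero => simp [ofBits]
  | bit b n h ih =>
    rw [Nat.bits_append_bit n b h]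
    simpa [ofBits] using congrArg (Nat.bit b) ih

/-- The message that carries a token, if there is one. A token is a pair of a level and the identity
of the node that issued it. It is sent as the level in unary, a separator, and the identity in
binary; the empty message stands for no token. -/
def encode : Option (ℕ × ℕ) → Message
  | none => []
  | some (l, x) => List.replicate l true ++ false :: x.bits

/-- The inverse of `encode`. -/
def decode : Message → Option (ℕ × ℕ)
  | [] => none
  | false :: w => some (0, ofBits w)
  | true :: w => (decode w).map fun p => (p.1 + 1, p.2)

@[simp]
theorem decode_encode (o : Option (ℕ × ℕ)) : decode (encode o) = o := by
  rcases o with _ | ⟨l, x⟩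
  · rfl
  · induction l with
    | zero => simp [encode, decode]
    | succ l ih =>
      simp only [encode, List.replicate_succ, List.cons_append, decode] at ih ⊢
      rw [ih]
      rfl

theorem length_encode_some (l x : ℕ) : (encode (some (l, x))).length = l + x.size + 1 := by
  simp [encode, Nat.size_eq_bits_len]
  ring

/-! ### The algorithm -/

/-- The number of leading `true`s among the `len` coins from position `start` on. -/
def leadingTrues (coin : ℕ → Bool) (start len : ℕ) : ℕ :=
  Nat.findGreatest (fun l => ∀ j < l, coin (start + j) = true) len

theorem leadingTrues_le (coin : ℕ → Bool) (start len : ℕ) :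
    leadingTrues coin start len ≤ len :=
  Nat.findGreatest_le _

theorem le_leadingTrues_iff {coin : ℕ → Bool} {start len l : ℕ} (hl : l ≤ len) :
    l ≤ leadingTrues coin start len ↔ ∀ j < l, coin (start + j) = true := by
  constructor
  · intro h j hj
    have := Nat.findGreatest_spec (P := fun l => ∀ j < l, coin (start + j) = true)
      (Nat.zero_le len) (by simp)
    exact this j (hj.trans_le h)
  · intro h
    exact Nat.le_findGreatest hl h

theorem leadingTrues_eq {coin : ℕ → Bool} {start len l : ℕ} (hl : l < len)
    (h : ∀ j < len, coin (start + j) = decide (j < l)) : leadingTrues coin start len = l := by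
  refine le_antisymm ?_ ((le_leadingTrues_iff hl.le).2 fun j hj => by
    simp [h j (hj.trans hl), hj])
  by_contra! hc
  have := (le_leadingTrues_iff (Nat.succ_le_of_lt hl)).1 hc l (Nat.lt_succ_self l)
  simp [h l hl] at this

open Classical in
/-- A received token of maximal level, if there is a token. -/
noncomputable def best {d : ℕ} (inbox : Fin d → Option (ℕ × ℕ)) : Option (ℕ × ℕ) :=
  if h : ∃ x, (∃ i, inbox i = some x) ∧ ∀ j y, inbox j = some y → y.1 ≤ x.1 then
    some h.choose
  else none

theorem exists_of_best_eq_some {d : ℕ} {inbox : Fin d → Option (ℕ × ℕ)} {x : ℕ × ℕ}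
    (h : best inbox = some x) : ∃ i, inbox i = some x := by
  unfold best at h
  split_ifs at h with hx
  cases h
  exact hx.choose_spec.1

theorem exists_best_eq_some {d : ℕ} {inbox : Fin d → Option (ℕ × ℕ)} {i : Fin d} {y : ℕ × ℕ}
    (h : inbox i = some y) : ∃ x, best inbox = some x ∧ y.1 ≤ x.1 := by
  have hx : ∃ x, (∃ i, inbox i = some x) ∧ ∀ j y, inbox j = some y → y.1 ≤ x.1 := by
    obtain ⟨j, hj, hmax⟩ := (Finset.univ.filter fun j => inbox j ≠ none).exists_max_image
      (fun j => ((inbox j).getD (0, 0)).1) ⟨i, by simp [h]⟩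
    obtain ⟨x, hx⟩ := Option.ne_none_iff_exists'.1 (Finset.mem_filter.1 hj).2
    refine ⟨x, ⟨j, hx⟩, fun j' y' hy' => ?_⟩
    simpa [hx, hy'] using hmax j' (by simp [hy'])
  refine ⟨hx.choose, ?_, hx.choose_spec.2 i y h⟩
  unfold best
  rw [dif_pos hx]

/-- The state of a node. `bound` is the largest identity seen so far, `level` gives the levels of
the tokens that the node issues through its links (with the number of the link as argument),
`token` is the last token it has stored. -/
structure NodeState where
  clock : ℕ
  ident : ℕ
  bound : ℕ
  degree : ℕ
  color : ℕ
  level : ℕ → ℕ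
  token : Option (ℕ × ℕ)
  rejected : Bool

/-- The number of coins tossed per link, and thus the largest possible level, at a node that has
seen the identity `M`. -/
def precision (M : ℕ) : ℕ := 6 * M.size + 5

/-- After `R` preliminary rounds, a phase starts every `k` rounds. -/
def PhaseStart (k R t : ℕ) : Prop := R ≤ t ∧ (t - R) % k = 0

instance (k R t : ℕ) : Decidable (PhaseStart k R t) := inferInstanceAs (Decidable (_ ∧ _))

/-- At the start of a phase, a node tosses `k` coins for its color and `precision` coins for each
of its links. -/
def tosses (k R : ℕ) (s : NodeState) : ℕ :=
  if PhaseStart k R s.clock then k + s.degree * precision s.bound else 0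

/-- The coins of a node as a sequence, continued by `false`. -/
def extend {c : ℕ} (r : Fin c → Bool) (x : ℕ) : Bool := if h : x < c then r ⟨x, h⟩ else false

/-- The color is read from the first `k` coins; then every link has its own block of coins. -/
def draw (k : ℕ) (s : NodeState) (coin : ℕ → Bool) : NodeState :=
  { s with
    color := leadingTrues coin 0 k
    level := fun i => leadingTrues coin (k + i * precision s.bound) (precision s.bound) }

/-- The token that leaves a node through its link number `i` in the round `c` of a phase. -/
def outgoing (c : ℕ) (s : NodeState) (i : ℕ) : Option (ℕ × ℕ) :=
  if s.color = c then if c = 0 then some (s.level i, s.ident) else s.token else none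

open Classical in
/-- The new state of a node after the round `c` of a phase. -/
noncomputable def absorb (k c : ℕ) {d : ℕ} (s : NodeState) (inbox : Fin d → Option (ℕ × ℕ)) :
    NodeState :=
  { s with
    clock := s.clock + 1
    token := if s.color = c + 1 then best inbox else s.token
    rejected := s.rejected ||
      decide (c + 1 = k ∧ s.color = 0 ∧ ∃ i l, inbox i = some (l, s.ident)) }

/-- The tester. In `R` preliminary rounds the nodes learn their degree and the largest identity
within distance `R`. Each of the following `T` phases consists of `k` rounds: the nodes draw random
colors in `0, …, k`, and every node of color `0` issues through each of its links a token with a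
random level. In the round `c` of the phase, the tokens move from nodes of color `c` to nodes of
color `c + 1` (modulo `k`), where only a token of maximal level survives. A node to which a token
of its own comes back rejects. The color `k` occurs only because the color is read off as a number
of leading `true`s; nodes of this color send nothing. -/
noncomputable def tester (k R T : ℕ) : Algorithm where
  State := NodeState
  rounds := R + k * T
  start x :=
    { clock := 0, ident := x, bound := x, degree := 0, color := 0, level := fun _ => 0,
      token := none, rejected := false }
  coins s := tosses k R s
  compute s r := if PhaseStart k R s.clock then draw k s (extend r) else s
  send s i :=
    if s.clock < R then s.bound.bits else encode (outgoing ((s.clock - R) % k) s i)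
  receive {d} s msgs :=
    if s.clock < R then
      { s with
        clock := s.clock + 1
        degree := d
        bound := max s.bound (Finset.univ.sup fun i => ofBits (msgs i)) }
    else absorb k ((s.clock - R) % k) s fun i => decode (msgs i)
  output s := if s.rejected then Verdict.reject else Verdict.accept

/-! ### Executions in general -/

/-- The random configuration reached from the configuration `s` in a given number of rounds. -/
noncomputable def advance (A : Algorithm) (N : Network) (s : A.Config N) :
    ℕ → PMF (A.Config N)
  | 0 => PMF.pure s
  | j + 1 => (advance A N s j).bind fun s' => (A.computePhase N s').map (A.communicate N)

theorem afterRounds_add (A : Algorithm) (N : Network) (t j : ℕ) :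
    A.afterRounds N (t + j) = (A.afterRounds N t).bind fun s => advance A N s j := by
  induction j with
  | zero => simp [advance]
  | succ j ih => rw [← add_assoc, Algorithm.afterRounds, ih, PMF.bind_bind]; rfl

theorem computePhase_support {A : Algorithm} {N : Network} {s s' : A.Config N}
    (h : s' ∈ (A.computePhase N s).support) :
    ∃ r : (v : N.V) → Fin (A.coins (s v)) → Bool, s' = fun v => A.compute (s v) (r v) := by
  obtain ⟨r, -, rfl⟩ := (PMF.mem_support_map_iff _ _ _).1 h
  exact ⟨r, rfl⟩

/-- A property of configurations that every round preserves holds throughout. -/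
theorem afterRounds_induction {A : Algorithm} {N : Network} {P : ℕ → A.Config N → Prop}
    (h0 : P 0 fun v => A.start (N.id v))
    (hs : ∀ t s, P t s → ∀ r : (v : N.V) → Fin (A.coins (s v)) → Bool,
      P (t + 1) (A.communicate N fun v => A.compute (s v) (r v)))
    (t : ℕ) {s : A.Config N} (h : s ∈ (A.afterRounds N t).support) : P t s := by
  induction t generalizing s with
  | zero =>
    rw [Algorithm.afterRounds, PMF.support_pure, Set.mem_singleton_iff] at h
    exact h ▸ h0
  | succ t ih =>
    rw [Algorithm.afterRounds, PMF.mem_support_bind_iff] at h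
    obtain ⟨s', hs', h⟩ := h
    obtain ⟨s'', h'', rfl⟩ := (PMF.mem_support_map_iff _ _ _).1 h
    obtain ⟨r, rfl⟩ := computePhase_support h''
    exact hs t s' (ih hs') r

/-! ### Size of the messages -/

/-- Bounds on the numbers in the state of a node, in a network with identities at most `B`. -/
structure Small (B : ℕ) (s : NodeState) : Prop where
  ident : s.ident ≤ B
  bound : s.bound ≤ B
  level : ∀ i, s.level i ≤ precision B
  token : ∀ l x, s.token = some (l, x) → l ≤ precision B ∧ x ≤ B

theorem precision_mono {M B : ℕ} (h : M ≤ B) : precision M ≤ precision B := by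
  have := Nat.size_le_size h
  unfold precision
  omega

theorem Small.outgoing {B : ℕ} {s : NodeState} (h : Small B s) {c i l x : ℕ}
    (ho : outgoing c s i = some (l, x)) : l ≤ precision B ∧ x ≤ B := by
  unfold CycleTester.outgoing at ho
  split_ifs at ho
  · cases ho
    exact ⟨h.level i, h.ident⟩
  · exact h.token l x ho

theorem Small.compute {B k R T : ℕ} {s : NodeState} (h : Small B s)
    (r : Fin (tosses k R s) → Bool) : Small B ((tester k R T).compute s r) := by
  simp only [tester]
  split_ifs
  · exact ⟨h.ident, h.bound,
      fun i => (leadingTrues_le _ _ _).trans (precision_mono h.bound), h.token⟩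
  · exact h

theorem Small.communicate {B k R T : ℕ} {N : Network} {s : (tester k R T).Config N}
    {t : ℕ} (hc : ∀ v, (s v).clock = t) (h : ∀ v, Small B (s v)) (v : N.V) :
    Small B ((tester k R T).communicate N s v) := by
  simp only [Algorithm.communicate, tester, hc]
  split_ifs
  · refine ⟨(h v).ident, max_le (h v).bound (Finset.sup_le fun i _ => ?_), (h v).level,
      (h v).token⟩
    simpa using (h _).bound
  · refine ⟨(h v).ident, (h v).bound, (h v).level, fun l x hx => ?_⟩
    simp only [absorb, decode_encode] at hx
    split_ifs at hx
    · obtain ⟨i, hi⟩ := exists_of_best_eq_some hx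
      exact (h _).outgoing hi
    · exact (h v).token l x hx

theorem compute_clock {k R T : ℕ} (s : NodeState) (r : Fin (tosses k R s) → Bool) :
    ((tester k R T).compute s r).clock = s.clock := by
  simp only [tester]
  split_ifs <;> rfl

theorem communicate_clock {k R T : ℕ} {N : Network} (s : (tester k R T).Config N) (v : N.V) :
    ((tester k R T).communicate N s v).clock = (s v).clock + 1 := by
  simp only [Algorithm.communicate, tester]
  split_ifs <;> rfl

theorem afterRounds_small {B k R T t : ℕ} {N : Network} (hB : ∀ v, N.id v ≤ B)
    {s : (tester k R T).Config N} (hs : s ∈ ((tester k R T).afterRounds N t).support) :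
    ∀ v, (s v).clock = t ∧ Small B (s v) := by
  refine afterRounds_induction (A := tester k R T)
    (P := fun t s => ∀ v, (s v).clock = t ∧ Small B (s v)) ?_ ?_ t hs
  · exact fun v => ⟨rfl, hB v, hB v, fun i => Nat.zero_le _, by simp [tester]⟩
  · intro t s h r v
    have hc : ∀ v, ((tester k R T).compute (s v) (r v)).clock = t := fun v =>
      (compute_clock (s v) (r v)).trans (h v).1
    exact ⟨(communicate_clock _ v).trans (congrArg (· + 1) (hc v)),
      Small.communicate hc (fun v => (h v).2.compute (r v)) v⟩

theorem length_send_le {B k R T d : ℕ} {s : NodeState} (h : Small B s) (i : Fin d) :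
    ((tester k R T).send s i).length ≤ 7 * B.size + 6 := by
  simp only [tester]
  split_ifs
  · rw [Nat.size_eq_bits_len]
    have := Nat.size_le_size h.bound
    omega
  · rcases ho : CycleTester.outgoing ((s.clock - R) % k) s i with _ | ⟨l, x⟩
    · simp [encode]
    · have h1 := h.outgoing ho
      have h2 := Nat.size_le_size h1.2
      rw [length_encode_some]
      unfold precision at h1
      omega

/-- Identities at most `a * n ^ b` have `O(log n)` bits. -/
theorem size_mul_pow_le {n : ℕ} (hn : 2 ≤ n) (a b : ℕ) :
    ((a * n ^ b).size : ℝ) ≤ (a.size + 2 * b) * Real.logb 2 n := by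
  have h1 : 1 ≤ Real.logb 2 n := by
    rw [Real.le_logb_iff_rpow_le (by norm_num) (by positivity)]
    exact_mod_cast by simpa using hn
  have h2 : (n.size : ℝ) ≤ 2 * Real.logb 2 n := by
    have hs : 2 ^ (n.size - 1) ≤ n :=
      Nat.lt_size.1 (Nat.sub_lt (Nat.size_pos.2 (by omega)) one_pos)
    have : ((n.size - 1 : ℕ) : ℝ) ≤ Real.logb 2 n := by
      rw [Real.le_logb_iff_rpow_le (by norm_num) (by positivity), Real.rpow_natCast]
      exact_mod_cast hs
    have h3 : (n.size : ℝ) ≤ ((n.size - 1 : ℕ) : ℝ) + 1 := by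
      exact_mod_cast (by omega : n.size ≤ n.size - 1 + 1)
    linarith
  have h3 : (a * n ^ b).size ≤ a.size + b * n.size := by
    rw [Nat.size_le, pow_add, mul_comm b, pow_mul]
    calc a * n ^ b < 2 ^ a.size * n ^ b :=
          Nat.mul_lt_mul_of_pos_right (Nat.lt_size_self a) (by positivity)
      _ ≤ _ := Nat.mul_le_mul_left _ (Nat.pow_le_pow_left (Nat.lt_size_self n).le b)
  calc ((a * n ^ b).size : ℝ) ≤ a.size + b * n.size := by exact_mod_cast h3
    _ ≤ a.size * Real.logb 2 n + b * (2 * Real.logb 2 n) := by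
        gcongr
        exact le_mul_of_one_le_right (Nat.cast_nonneg _) h1
    _ = _ := by ring

theorem two_le_n_of_port {N : Network} {v : N.V} (i : Fin (N.deg v)) : 2 ≤ N.n := by
  have h : v ≠ N.port v i := (N.port v i).2.ne
  have := Fintype.one_lt_card_iff.2 ⟨v, _, h⟩
  exact this

theorem messagesBoundedBy (k R T a b : ℕ) {N : Network} (hid : ∀ v, N.id v ≤ a * N.n ^ b) :
    (tester k R T).MessagesBoundedBy N ((7 * (a.size + 2 * b) + 6) * Real.logb 2 N.n) := by
  intro t _ s hs v i
  rw [Algorithm.whenSending, PMF.mem_support_bind_iff] at hs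
  obtain ⟨s', hs', h⟩ := hs
  obtain ⟨r, rfl⟩ := computePhase_support h
  have hn := two_le_n_of_port i
  have h1 := length_send_le (k := k) (R := R) (T := T)
    (((afterRounds_small hid hs' v).2).compute (T := T) (r v)) i
  have h2 := size_mul_pow_le hn a b
  have h3 : 1 ≤ Real.logb 2 N.n := by
    rw [Real.le_logb_iff_rpow_le (by norm_num) (by positivity)]
    exact_mod_cast by simpa using hn
  calc _ ≤ ((7 * (a * N.n ^ b).size + 6 : ℕ) : ℝ) := by exact_mod_cast h1
    _ ≤ _ := by push_cast; nlinarith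

/-! ### A phase with given coins -/

/-- The configuration after the first `c` rounds of a phase, when `s` is the configuration right
after the coins have been used. -/
noncomputable def phaseState (k : ℕ) (N : Network) (s : N.V → NodeState) : ℕ → N.V → NodeState
  | 0 => s
  | c + 1 => fun v => absorb k c (phaseState k N s c v) fun i : Fin (N.deg v) =>
      outgoing c (phaseState k N s c (N.port v i)) (N.backPort v i)

section PhaseState

variable {k : ℕ} {N : Network} {s : N.V → NodeState}

@[simp]
theorem phaseState_ident (c : ℕ) (v : N.V) : (phaseState k N s c v).ident = (s v).ident := by
  induction c with
  | zero => rfl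
  | succ c ih => exact ih

@[simp]
theorem phaseState_color (c : ℕ) (v : N.V) : (phaseState k N s c v).color = (s v).color := by
  induction c with
  | zero => rfl
  | succ c ih => exact ih

@[simp]
theorem phaseState_level (c : ℕ) (v : N.V) : (phaseState k N s c v).level = (s v).level := by
  induction c with
  | zero => rfl
  | succ c ih => exact ih

theorem phaseState_clock (c : ℕ) (v : N.V) :
    (phaseState k N s c v).clock = (s v).clock + c := by
  induction c with
  | zero => rfl
  | succ c ih => exact congrArg (· + 1) ih

theorem phaseState_token_succ {c : ℕ} {v : N.V} (h : (s v).color = c + 1) :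
    (phaseState k N s (c + 1) v).token = best fun i : Fin (N.deg v) =>
      outgoing c (phaseState k N s c (N.port v i)) (N.backPort v i) := by
  simp [phaseState, absorb, h]

theorem phaseState_rejected_succ (c : ℕ) (v : N.V) :
    (phaseState k N s (c + 1) v).rejected = true ↔
      (phaseState k N s c v).rejected = true ∨ c + 1 = k ∧ (s v).color = 0 ∧
        ∃ (i : Fin (N.deg v)) (l : ℕ),
          outgoing c (phaseState k N s c (N.port v i)) (N.backPort v i) =
            some (l, (s v).ident) := by
  simp [phaseState, absorb]

/-- A node never withdraws a rejection. -/
theorem phaseState_rejected_mono {c : ℕ} {v : N.V} (h : (s v).rejected = true) :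
    (phaseState k N s c v).rejected = true := by
  induction c with
  | zero => exact h
  | succ c ih => exact (phaseState_rejected_succ c v).2 (Or.inl ih)

theorem outgoing_eq_some {c i : ℕ} {t : NodeState} {x : ℕ × ℕ} (h : outgoing c t i = some x) :
    t.color = c := by
  unfold outgoing at h
  by_contra hc
  simp [hc] at h

theorem outgoing_zero {i : ℕ} {t : NodeState} (h : t.color = 0) :
    outgoing 0 t i = some (t.level i, t.ident) := by
  simp [outgoing, h]

theorem outgoing_succ {c i : ℕ} {t : NodeState} (h : t.color = c + 1) :
    outgoing (c + 1) t i = t.token := by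
  simp [outgoing, h]

/-- A token has traveled along a path on which the colors are `0, 1, 2, …`. -/
theorem exists_path_of_outgoing {c : ℕ} {v : N.V} {i l x : ℕ}
    (h : outgoing c (phaseState k N s c v) i = some (l, x)) :
    ∃ f : ℕ → N.V, (s (f 0)).ident = x ∧ f c = v ∧ (∀ j ≤ c, (s (f j)).color = j) ∧
      ∀ j < c, N.graph.Adj (f j) (f (j + 1)) := by
  induction c generalizing v i l with
  | zero =>
    have hc : (s v).color = 0 := outgoing_eq_some h
    rw [outgoing_zero (by simpa using hc)] at h
    refine ⟨fun _ => v, ?_, rfl, by simp [hc], by simp⟩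
    simpa using congrArg Prod.snd (Option.some.inj h)
  | succ c ih =>
    have hc : (s v).color = c + 1 := by simpa using outgoing_eq_some h
    rw [outgoing_succ (by simpa using hc), phaseState_token_succ hc] at h
    obtain ⟨i', hi'⟩ := exists_of_best_eq_some h
    obtain ⟨f, h0, hfc, hcol, hadj⟩ := ih hi'
    refine ⟨fun j => if j ≤ c then f j else v, by simpa using h0, by simp, ?_, ?_⟩
    · intro j hj
      rcases hj.lt_or_eq with hj | rfl
      · simp [Nat.lt_succ_iff.1 hj, hcol]
      · simp [hc]
    · intro j hj
      rcases (Nat.lt_succ_iff.1 hj).lt_or_eq with hj | rfl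
      · simpa [hj.le, Nat.succ_le_of_lt hj] using hadj j hj
      · simpa [hfc] using (N.port v i').2.symm

/-- A closed walk whose `k` nodes have the colors `0, …, k - 1` is a `k`-node cycle. -/
theorem not_cycleFree_of_colored (hk : 3 ≤ k) (col : N.V → ℕ) {f : ℕ → N.V}
    (hcol : ∀ j < k, col (f j) = j) (hadj : ∀ j < k - 1, N.graph.Adj (f j) (f (j + 1)))
    (hlast : N.graph.Adj (f (k - 1)) (f 0)) : ¬ N.CycleFree k := by
  obtain ⟨m, rfl⟩ : ∃ m, k = m + 2 := ⟨k - 2, by omega⟩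
  have key : ∀ u v : Fin (m + 2), v - u = 1 → N.graph.Adj (f u) (f v) := by
    intro u v huv
    obtain rfl : v = u + 1 := by rw [← huv]; abel
    by_cases hu : u = Fin.last (m + 1)
    · subst hu
      simpa using hlast
    · rw [Fin.val_add_one_of_lt (Fin.lt_last_iff_ne_last.2 hu)]
      exact hadj u (Fin.lt_last_iff_ne_last.2 hu)
  unfold Network.CycleFree SimpleGraph.Free
  rw [not_not]
  refine ⟨⟨⟨fun j => f j, ?_⟩, ?_⟩⟩
  · intro u v huv
    rcases (SimpleGraph.cycleGraph_adj.1 huv) with h | h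
    · exact (key v u h).symm
    · exact key u v h
  · intro u v huv
    have := congrArg col huv
    exact Fin.ext (by simpa [hcol u u.2, hcol v v.2] using this)

/-- A rejection reveals a `k`-node cycle. -/
theorem not_cycleFree_of_rejected (hk : 3 ≤ k) (hid : ∀ v, (s v).ident = N.id v) {v : N.V}
    (h : (phaseState k N s k v).rejected = true) (h0 : (s v).rejected = false) :
    ¬ N.CycleFree k := by
  have hearly : ∀ c < k, (phaseState k N s c v).rejected = false := by
    intro c hc
    induction c with
    | zero => exact h0
    | succ c ih =>
      by_contra hr
      rw [Bool.not_eq_false, phaseState_rejected_succ, ih (by omega)] at hr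
      simp [hc.ne] at hr
  obtain ⟨m, rfl⟩ : ∃ m, k = m + 1 := ⟨k - 1, by omega⟩
  rw [phaseState_rejected_succ, hearly m (by omega)] at h
  obtain ⟨-, hcol0, i, l, hi⟩ := h.resolve_left (by simp)
  obtain ⟨f, hx, hfm, hcol, hadj⟩ := exists_path_of_outgoing hi
  rw [hid, hid] at hx
  have hf0 : f 0 = v := N.id_injective hx
  refine not_cycleFree_of_colored hk (fun w => (s w).color) (f := f)
    (fun j hj => hcol j (by omega)) hadj ?_
  simp only [Nat.add_sub_cancel, hf0, hfm]
  exact (N.port v i).2.symm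

/-- A link seen from its other end. -/
theorem exists_reverse_port (v : N.V) (i : Fin (N.deg v)) {w : N.V} (hw : (N.port v i : N.V) = w) :
    ∃ i' : Fin (N.deg w), (N.port w i' : N.V) = v ∧ (N.backPort w i' : ℕ) = i := by
  subst hw
  have hback : ∀ u (hu : u = v) (hadj : (N.port v i : N.V) ∈ N.graph.neighborSet u),
      ((N.port u).symm ⟨N.port v i, hadj⟩ : ℕ) = i := by
    rintro u rfl hadj
    simp
  have hv : (N.port (N.port v i) (N.backPort v i) : N.V) = v := by simp [Network.backPort]
  exact ⟨N.backPort v i, hv, hback _ hv _⟩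

/-- If the colors along a `k`-node cycle are `0, …, k - 1` and the token issued through its first
link is the only one of level at least `L`, then this token is never discarded on its way around
the cycle, so that the first node rejects. -/
theorem rejected_of_unique_level {L : ℕ} {f : ℕ → N.V} {i₀ : Fin (N.deg (f 0))} (hk : 2 ≤ k)
    (hcol : ∀ j < k, (s (f j)).color = j) (hadj : ∀ j < k - 1, N.graph.Adj (f j) (f (j + 1)))
    (hlast : N.graph.Adj (f (k - 1)) (f 0)) (hi₀ : N.port (f 0) i₀ = f 1)
    (hL : L ≤ (s (f 0)).level i₀)
    (huniq : ∀ v (i : Fin (N.deg v)), L ≤ (s v).level i → v = f 0) :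
    (phaseState k N s k (f 0)).rejected = true := by
  -- A token of level at least `L` was issued by `f 0`.
  have hissuer : ∀ c v (i : Fin (N.deg v)) l x,
      outgoing c (phaseState k N s c v) i = some (l, x) → L ≤ l → x = (s (f 0)).ident := by
    intro c
    induction c with
    | zero =>
      intro v i l x h hl
      rw [outgoing_zero (outgoing_eq_some h)] at h
      obtain ⟨rfl, rfl⟩ := Prod.mk.inj (Option.some.inj h)
      rw [phaseState_level] at hl
      rw [phaseState_ident, huniq v i hl]
    | succ c ih =>
      intro v i l x h hl
      have hc : (s v).color = c + 1 := by simpa using outgoing_eq_some h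
      rw [outgoing_succ (by simpa using hc), phaseState_token_succ hc] at h
      obtain ⟨i', hi'⟩ := exists_of_best_eq_some h
      exact ih _ _ l x hi' hl
  have hport : ∀ u w, N.graph.Adj u w → ∃ i : Fin (N.deg u), (N.port u i : N.V) = w :=
    fun u w h => ⟨(N.port u).symm ⟨w, h⟩, by simp⟩
  -- The token reaches `f c` before the round `c`.
  have harrive : ∀ c, 1 ≤ c → c < k →
      ∃ l, L ≤ l ∧ (phaseState k N s c (f c)).token = some (l, (s (f 0)).ident) := by
    intro c hc1 hck
    induction c, hc1 using Nat.le_induction with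
    | base =>
      obtain ⟨i', hp, hb⟩ := exists_reverse_port (f 0) i₀ hi₀
      rw [phaseState_token_succ (hcol 1 hck)]
      obtain ⟨⟨l, x⟩, hx, hl⟩ := exists_best_eq_some (inbox := fun i : Fin (N.deg (f 1)) =>
        outgoing 0 (phaseState k N s 0 (N.port (f 1) i)) (N.backPort (f 1) i)) (i := i')
        (y := ((s (f 0)).level i₀, (s (f 0)).ident))
        (by
          simp only [hb, hp]
          exact outgoing_zero (hcol 0 (by omega)))
      obtain ⟨i'', hi''⟩ := exists_of_best_eq_some hx
      have hLl : L ≤ l := hL.trans hl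
      exact ⟨l, hLl, by rw [hx, hissuer 0 _ _ l x hi'' hLl]⟩
    | succ c hc1 ih =>
      obtain ⟨l, hLl, htok⟩ := ih (by omega)
      obtain ⟨i', hp⟩ := hport _ _ (hadj c (by omega)).symm
      rw [phaseState_token_succ (hcol (c + 1) hck)]
      obtain ⟨d, rfl⟩ : ∃ d, c = d + 1 := ⟨c - 1, by omega⟩
      obtain ⟨⟨l', x⟩, hx, hl⟩ := exists_best_eq_some
        (inbox := fun i : Fin (N.deg (f (d + 1 + 1))) =>
          outgoing (d + 1) (phaseState k N s (d + 1) (N.port (f (d + 1 + 1)) i))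
            (N.backPort (f (d + 1 + 1)) i)) (i := i') (y := (l, (s (f 0)).ident))
        (by
          simp only [hp]
          rw [outgoing_succ (by simpa using hcol (d + 1) (by omega)), htok])
      obtain ⟨i'', hi''⟩ := exists_of_best_eq_some hx
      have hLl' : L ≤ l' := hLl.trans hl
      exact ⟨l', hLl', by rw [hx, hissuer _ _ _ l' x hi'' hLl']⟩
  obtain ⟨m, rfl⟩ : ∃ m, k = m + 2 := ⟨k - 2, by omega⟩
  obtain ⟨l, -, htok⟩ := harrive (m + 1) (by omega) (by omega)
  obtain ⟨i', hp⟩ := hport _ _ hlast.symm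
  refine (phaseState_rejected_succ (m + 1) _).2 (Or.inr ⟨rfl, hcol 0 (by omega), i', l, ?_⟩)
  simp only [hp, Nat.add_succ_sub_one]
  rw [outgoing_succ (by simpa using hcol (m + 1) (by omega)), htok]

end PhaseState

/-! ### The distribution of the outcome of a phase -/

theorem communicate_eq {k R T j c : ℕ} (hc : c < k) {N : Network} {s : N.V → NodeState}
    (hs : ∀ v, (s v).clock = R + k * j + c) :
    (tester k R T).communicate N s = fun v => absorb k c (s v) fun i : Fin (N.deg v) =>
      outgoing c (s (N.port v i)) (N.backPort v i) := by
  have h : ∀ v, ¬ (s v).clock < R := fun v => by rw [hs]; omega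
  have h' : ∀ v, ((s v).clock - R) % k = c := fun v => by
    rw [hs, add_assoc, Nat.add_sub_cancel_left, Nat.mul_add_mod, Nat.mod_eq_of_lt hc]
  funext v
  simp only [Algorithm.communicate, tester, h, h', if_false, decode_encode]

theorem computePhase_eq_pure {k R T : ℕ} {N : Network} {s : N.V → NodeState}
    (h : ∀ v, ¬ PhaseStart k R (s v).clock) :
    (tester k R T).computePhase N s = PMF.pure s := by
  have hconst : (fun (r : (v : N.V) → Fin (tosses k R (s v)) → Bool) v =>
      (tester k R T).compute (s v) (r v)) = Function.const _ s := by
    funext r v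
    change (tester k R T).compute (s v) (r v) = s v
    simp [tester, h]
  exact (congrArg (PMF.map · (PMF.uniformOfFintype _)) hconst).trans (PMF.map_const _ _)

/-- The coins of all the nodes in the first round of a phase that starts at `s`. -/
abbrev Coins (k R : ℕ) (N : Network) (s : N.V → NodeState) : Type :=
  (v : N.V) → Fin (tosses k R (s v)) → Bool

/-- The configuration after the coins `r` have been used. -/
def drawn {k R : ℕ} {N : Network} {s : N.V → NodeState} (r : Coins k R N s) :
    N.V → NodeState := fun v => draw k (s v) (extend (r v))

theorem advance_phase {k R T j : ℕ} {N : Network} {s : N.V → NodeState}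
    (hs : ∀ v, (s v).clock = R + k * j) {c : ℕ} (hc : c < k) :
    advance (tester k R T) N s (c + 1) =
      (PMF.uniformOfFintype (Coins k R N s)).map fun r => phaseState k N (drawn r) (c + 1) := by
  induction c with
  | zero =>
    have hstart : ∀ v, PhaseStart k R (s v).clock := fun v => by
      rw [hs]
      exact ⟨by omega, by simp⟩
    have hdraw : (tester k R T).computePhase N s =
        (PMF.uniformOfFintype (Coins k R N s)).map drawn := by
      refine congrArg (PMF.map · (PMF.uniformOfFintype (Coins k R N s))) ?_
      funext r v
      simp [tester, hstart, drawn]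
    refine (PMF.pure_bind _ _).trans ?_
    refine (congrArg (PMF.map _) hdraw).trans ((PMF.map_comp _ _ _).trans ?_)
    refine congrArg (PMF.map · (PMF.uniformOfFintype (Coins k R N s))) ?_
    funext r
    exact communicate_eq hc (fun v => hs v)
  | succ c ih =>
    change (advance (tester k R T) N s (c + 1)).bind _ = _
    rw [ih (by omega)]
    refine (PMF.bind_map _ _ _).trans ?_
    rw [← PMF.bind_pure_comp]
    refine congrArg (PMF.bind (PMF.uniformOfFintype (Coins k R N s))) ?_
    funext r
    have hclock : ∀ v, (phaseState k N (drawn r) (c + 1) v).clock = R + k * j + (c + 1) :=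
      fun v => by rw [phaseState_clock]; exact congrArg (· + (c + 1)) (hs v)
    have hno : ∀ v, ¬ PhaseStart k R (phaseState k N (drawn r) (c + 1) v).clock := by
      rintro v ⟨-, h⟩
      rw [hclock, add_assoc, Nat.add_sub_cancel_left, Nat.mul_add_mod, Nat.mod_eq_of_lt hc] at h
      omega
    refine (congrArg (PMF.map _) (computePhase_eq_pure hno)).trans ((PMF.pure_map _ _).trans ?_)
    exact congrArg PMF.pure (communicate_eq hc hclock)

/-! ### What the nodes know after the preliminary rounds -/

/-- Every node knows its identity and its degree, and has seen all identities within
distance `R`. -/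
structure Informed (R : ℕ) (N : Network) (s : N.V → NodeState) : Prop where
  ident : ∀ v, (s v).ident = N.id v
  degree : ∀ v, (s v).degree = N.deg v
  reach : ∀ v w (p : N.graph.Walk v w), p.length ≤ R → N.id w ≤ (s v).bound

theorem compute_bound {k R T : ℕ} (s : NodeState) (r : Fin (tosses k R s) → Bool) :
    ((tester k R T).compute s r).bound = s.bound := by
  simp only [tester]
  split_ifs <;> rfl

theorem compute_ident {k R T : ℕ} (s : NodeState) (r : Fin (tosses k R s) → Bool) :
    ((tester k R T).compute s r).ident = s.ident := by
  simp only [tester]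
  split_ifs <;> rfl

theorem compute_degree {k R T : ℕ} (s : NodeState) (r : Fin (tosses k R s) → Bool) :
    ((tester k R T).compute s r).degree = s.degree := by
  simp only [tester]
  split_ifs <;> rfl

theorem compute_rejected {k R T : ℕ} (s : NodeState) (r : Fin (tosses k R s) → Bool) :
    ((tester k R T).compute s r).rejected = s.rejected := by
  simp only [tester]
  split_ifs <;> rfl

theorem communicate_ident {k R T : ℕ} {N : Network} (s : (tester k R T).Config N) (v : N.V) :
    ((tester k R T).communicate N s v).ident = (s v).ident := by
  simp only [Algorithm.communicate, tester]
  split_ifs <;> rfl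

theorem communicate_degree {k R T : ℕ} {N : Network} (s : (tester k R T).Config N) (v : N.V) :
    ((tester k R T).communicate N s v).degree =
      if (s v).clock < R then N.deg v else (s v).degree := by
  simp only [Algorithm.communicate, tester]
  split_ifs <;> rfl

theorem le_communicate_bound {k R T : ℕ} {N : Network} (s : (tester k R T).Config N) (v : N.V) :
    (s v).bound ≤ ((tester k R T).communicate N s v).bound := by
  simp only [Algorithm.communicate, tester]
  split_ifs
  · exact le_max_left _ _
  · exact le_rfl

theorem neighbor_le_communicate_bound {k R T t : ℕ} {N : Network} {s : (tester k R T).Config N}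
    (ht : t < R) (hs : ∀ v, (s v).clock = t) {v w : N.V} (h : N.graph.Adj v w) :
    (s w).bound ≤ ((tester k R T).communicate N s v).bound := by
  simp only [Algorithm.communicate, tester, hs, ht, if_true, ofBits_bits]
  refine le_max_of_le_right ?_
  have hw : (N.port v ((N.port v).symm ⟨w, h⟩) : N.V) = w := by simp
  refine le_trans ?_ (Finset.le_sup (f := fun i : Fin (N.deg v) => (s (N.port v i)).bound)
    (Finset.mem_univ ((N.port v).symm ⟨w, h⟩)))
  simp only [hw]
  exact le_rfl

theorem afterRounds_clock_and_reach {k R T t : ℕ} {N : Network} {s : (tester k R T).Config N}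
    (hs : s ∈ ((tester k R T).afterRounds N t).support) (v : N.V) :
    (s v).clock = t ∧ (s v).ident = N.id v ∧ (0 < R → 0 < t → (s v).degree = N.deg v) ∧
      ∀ w (p : N.graph.Walk v w), p.length ≤ min t R → N.id w ≤ (s v).bound := by
  refine afterRounds_induction (A := tester k R T) (P := fun t s => ∀ v : N.V,
    (s v).clock = t ∧ (s v).ident = N.id v ∧ (0 < R → 0 < t → (s v).degree = N.deg v) ∧
      ∀ w (p : N.graph.Walk v w), p.length ≤ min t R → N.id w ≤ (s v).bound) ?_ ?_ t hs v
  · refine fun v => ⟨rfl, rfl, fun _ h => absurd h (lt_irrefl 0), fun w p hp => ?_⟩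
    obtain rfl := SimpleGraph.Walk.eq_of_length_eq_zero (p := p) (by simpa using hp)
    exact le_rfl
  · intro t s h r v
    set s' : (tester k R T).Config N := fun v => (tester k R T).compute (s v) (r v) with hs'
    have hc : ∀ v, (s' v).clock = t := fun v => (compute_clock (s v) (r v)).trans (h v).1
    have hb : ∀ v, (s' v).bound = (s v).bound := fun v => compute_bound (s v) (r v)
    have hle : (s v).bound ≤ ((tester k R T).communicate N s' v).bound :=
      (hb v).symm.le.trans (le_communicate_bound s' v)
    refine ⟨(communicate_clock s' v).trans (congrArg (· + 1) (hc v)),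
      (communicate_ident s' v).trans ((compute_ident (s v) (r v)).trans (h v).2.1),
      fun hR _ => ?_, fun w p hp => ?_⟩
    · rw [communicate_degree, hc]
      split_ifs with ht
      · rfl
      · exact (compute_degree (s v) (r v)).trans ((h v).2.2.1 hR (by omega))
    · by_cases ht : t < R
      · cases p with
        | nil => exact ((h v).2.2.2 v .nil (by simp)).trans hle
        | cons hadj q =>
          rw [SimpleGraph.Walk.length_cons] at hp
          exact (((h _).2.2.2 w q (by omega)).trans (hb _).symm.le).trans
            (neighbor_le_communicate_bound ht hc hadj)
      · exact ((h v).2.2.2 w p (by omega)).trans hle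

theorem informed_afterRounds {k R T t : ℕ} (hR : 0 < R) (ht : R ≤ t) {N : Network}
    {s : (tester k R T).Config N} (hs : s ∈ ((tester k R T).afterRounds N t).support) :
    Informed R N s where
  ident v := (afterRounds_clock_and_reach hs v).2.1
  degree v := (afterRounds_clock_and_reach hs v).2.2.1 hR (hR.trans_le ht)
  reach v w p hp := (afterRounds_clock_and_reach hs v).2.2.2 w p (by omega)

/-- Identities are distinct, so few of them are small. -/
theorem card_le_of_id_le {N : Network} (S : Finset N.V) {M : ℕ} (h : ∀ w ∈ S, N.id w ≤ M) :
    S.card ≤ M + 1 := by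
  have := Finset.card_le_card_of_injOn (t := Finset.range (M + 1)) N.id
    (fun w hw => by simpa [Nat.lt_succ_iff] using h w hw) N.id_injective.injOn
  simpa using this

namespace Informed

variable {R : ℕ} {N : Network} {s : N.V → NodeState}

theorem id_le (h : Informed R N s) (v : N.V) : N.id v ≤ (s v).bound :=
  h.reach v v .nil (by simp)

theorem deg_le (h : Informed R N s) (hR : 0 < R) (v : N.V) : N.deg v ≤ (s v).bound := by
  have hinj : Function.Injective fun i => (N.port v i : N.V) :=
    Subtype.val_injective.comp (N.port v).injective
  have hv : v ∉ Finset.univ.image fun i => (N.port v i : N.V) := by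
    simp only [Finset.mem_image, Finset.mem_univ, true_and, not_exists]
    exact fun i hi => (N.port v i).2.ne hi.symm
  have hcard := card_le_of_id_le (insert v (Finset.univ.image fun i => (N.port v i : N.V)))
    (M := (s v).bound) (by
      simp only [Finset.mem_insert, Finset.mem_image, Finset.mem_univ, true_and]
      rintro w (rfl | ⟨i, rfl⟩)
      · exact h.id_le w
      · exact h.reach v _ (SimpleGraph.Adj.toWalk (N.port v i).2) hR)
  rw [Finset.card_insert_of_notMem hv, Finset.card_image_of_injective _ hinj] at hcard
  simpa using hcard

/-- The ball of radius `R` around a node either is the whole network or has more than `R` nodes;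
so the node has seen an identity that is at least as large as one of `R` and `n - 1`. -/
theorem n_le_or_le_bound (h : Informed R N s) (v : N.V) :
    N.n ≤ (s v).bound + 1 ∨ R ≤ (s v).bound := by
  by_cases hall : ∀ w, N.graph.dist v w ≤ R
  · left
    refine card_le_of_id_le Finset.univ fun w _ => ?_
    obtain ⟨p, hp⟩ := N.connected.exists_walk_length_eq_dist v w
    exact h.reach v w p (hp ▸ hall w)
  · right
    push Not at hall
    obtain ⟨w, hw⟩ := hall
    obtain ⟨p, hp⟩ := N.connected.exists_walk_length_eq_dist v w
    have hinj := (p.isPath_of_length_eq_dist hp).getVert_injOn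
    have hcard := card_le_of_id_le ((Finset.range (R + 1)).image p.getVert)
      (M := (s v).bound) (by
        simp only [Finset.mem_image, Finset.mem_range]
        rintro _ ⟨j, hj, rfl⟩
        exact h.reach v _ (p.take j) (by rw [SimpleGraph.Walk.take_length]; omega))
    rw [Finset.card_image_of_injOn] at hcard
    · simpa using hcard
    · refine hinj.mono fun j hj => ?_
      simp only [Finset.coe_range, Set.mem_Iio, Set.mem_ofPred_eq] at hj ⊢
      omega

end Informed

/-! ### Links on cycles -/

/-- The links of a network, every edge being counted once for each of its ends. -/
abbrev Dart (N : Network) : Type := Σ v : N.V, Fin (N.deg v)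

theorem card_dart (N : Network) : Fintype.card (Dart N) = 2 * N.m := by
  classical
  have hdeg : ∀ v, N.deg v = N.graph.degree v := fun v => by
    rw [← SimpleGraph.card_neighborSet_eq_degree, ← Fintype.card_congr (N.port v),
      Fintype.card_fin]
  have := N.graph.sum_degrees_eq_twice_card_edges
  rw [Fintype.card_sigma, Network.m, ← SimpleGraph.coe_edgeFinset, Set.ncard_coe_finset, ← this]
  simp [hdeg]

theorem two_mul_m_le (N : Network) : 2 * N.m ≤ N.n ^ 2 := by
  classical
  rw [← card_dart, sq]
  refine (Fintype.card_le_of_injective (fun q : Dart N => (q.1, (N.port q.1 q.2 : N.V))) ?_).trans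
    (by simp [Network.n])
  rintro ⟨v, i⟩ ⟨w, j⟩ h
  obtain ⟨h1, h2⟩ := Prod.mk.inj h
  dsimp only at h1 h2
  subst h1
  rw [(N.port v).injective (Subtype.ext h2)]

theorem n_le_m_add_one (N : Network) : N.n ≤ N.m + 1 := by
  have := N.connected.card_vert_le_card_edgeSet_add_one
  simpa [Network.n, Network.m, Set.ncard] using this

/-- The walk `f 0, …, f (k - 1), f 0` is a `k`-node cycle with the given first link. -/
structure IsCycleFrom (N : Network) (k : ℕ) (q : Dart N) (f : ℕ → N.V) : Prop where
  injOn : Set.InjOn f (Set.Iio k)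
  start : f 0 = q.1
  second : (N.port q.1 q.2 : N.V) = f 1
  adj : ∀ j < k - 1, N.graph.Adj (f j) (f (j + 1))
  last : N.graph.Adj (f (k - 1)) (f 0)

/-- A link is good if it lies on a `k`-node cycle. -/
def GoodDart (N : Network) (k : ℕ) (q : Dart N) : Prop := ∃ f, IsCycleFrom N k q f

/-- In a network that is far from `C_k`-free, many links are on a `k`-node cycle: removing all of
them makes the network `C_k`-free. -/
theorem lt_ncard_goodDart {N : Network} {k : ℕ} {ε : ℝ} (hk : 3 ≤ k)
    (h : N.FarFromCycleFree k ε) : ε * N.m < ({q | GoodDart N k q}.ncard : ℝ) := by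
  obtain ⟨m, rfl⟩ : ∃ m, k = m + 2 := ⟨k - 2, by omega⟩
  set E : Set (Sym2 N.V) := (fun q : Dart N => s(q.1, (N.port q.1 q.2 : N.V))) ''
    {q | GoodDart N (m + 2) q} with hE
  by_contra! hle
  refine h (N.graph.deleteEdges E) (le_trans ?_ hle) ?_
  · have h1 : (symmDiff N.graph.edgeSet (N.graph.deleteEdges E).edgeSet).ncard ≤ E.ncard := by
      refine Set.ncard_le_ncard ?_ (Set.toFinite _)
      rw [SimpleGraph.edgeSet_deleteEdges]
      rintro e (⟨h1, h2⟩ | ⟨h1, h2⟩)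
      · by_contra he
        exact h2 ⟨h1, he⟩
      · exact absurd h1.1 h2
    exact_mod_cast h1.trans (Set.ncard_image_le (Set.toFinite _))
  · rintro ⟨φ⟩
    have hadj : ∀ u v : Fin (m + 2), v - u = 1 → (N.graph.deleteEdges E).Adj (φ u) (φ v) :=
      fun u v huv => φ.toHom.map_adj (SimpleGraph.cycleGraph_adj.2 (Or.inr huv))
    have h01 : (N.graph.deleteEdges E).Adj (φ 0) (φ 1) := hadj 0 1 (by simp)
    rw [SimpleGraph.deleteEdges_adj] at h01
    refine h01.2 ⟨⟨φ 0, (N.port (φ 0)).symm ⟨φ 1, h01.1⟩⟩, ⟨fun j => φ (Fin.ofNat (m + 2) j), ?_⟩,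
      by simp⟩
    refine ⟨?_, by simp, by simp; rfl, fun j hj => ?_, ?_⟩
    · intro i hi j hj hij
      have := congrArg Fin.val (φ.injective hij)
      simpa [Nat.mod_eq_of_lt (show i < m + 2 from hi),
        Nat.mod_eq_of_lt (show j < m + 2 from hj)] using this
    · refine (SimpleGraph.deleteEdges_adj.1 (hadj _ _ ?_)).1
      rw [sub_eq_iff_eq_add]
      exact Fin.ext (by simp [Fin.val_add, add_comm])
    · refine (SimpleGraph.deleteEdges_adj.1 (hadj _ _ ?_)).1
      simp [Fin.ofNat_eq_cast]

/-! ### Links of low precision -/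

/-- The links whose level cannot reach `L`. -/
def PoorDart {N : Network} (s : N.V → NodeState) (L : ℕ) (q : Dart N) : Prop :=
  precision (s q.1).bound < L

theorem pow_le_two_pow_precision (M : ℕ) : 32 * (M + 1) ^ 6 ≤ 2 ^ precision M := by
  have h : M + 1 ≤ 2 ^ M.size := Nat.lt_size_self M
  calc 32 * (M + 1) ^ 6 ≤ 32 * (2 ^ M.size) ^ 6 := by gcongr
    _ = 2 ^ precision M := by rw [precision, pow_add, ← pow_mul, mul_comm M.size]; norm_num; ring

/-- If `2 ^ L` is of the order of the number of edges, only a small proportion of the links are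
poor. -/
theorem ncard_poorDart_le {N : Network} {s : N.V → NodeState} {R : ℕ} {ε : ℝ} (hε : 0 < ε)
    (hR : 1 / ε ≤ R) (h : Informed R N s) (hm : 0 < N.m) :
    ({q | PoorDart s (Nat.clog 2 (4 * N.m)) q}.ncard : ℝ) ≤ ε * N.m / 2 := by
  classical
  have hR0 : 0 < R := by
    have : (0 : ℝ) < R := lt_of_lt_of_le (by positivity) hR
    exact_mod_cast this
  set S : Finset N.V :=
    Finset.univ.filter fun v => precision (s v).bound < Nat.clog 2 (4 * N.m) with hS
  rcases S.eq_empty_or_nonempty with hempty | hne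
  · have : {q : Dart N | PoorDart s (Nat.clog 2 (4 * N.m)) q} = ∅ := by
      ext q
      have hq : q.1 ∉ S := by simp [hempty]
      simpa [hS, PoorDart] using hq
    rw [this]
    simp
    positivity
  obtain ⟨v, hv, hmax⟩ := S.exists_max_image (fun v => (s v).bound) hne
  set μ := (s v).bound + 1 with hμ
  have hsmall : 16 * μ ^ 6 < N.n ^ 2 := by
    have h1 : precision (s v).bound < Nat.clog 2 (4 * N.m) := by simpa [hS] using hv
    have h2 : 2 ^ precision (s v).bound < 4 * N.m :=
      (Nat.lt_clog_iff_pow_lt (by norm_num)).1 h1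
    have h3 := pow_le_two_pow_precision (s v).bound
    rw [← hμ] at h3
    have h4 := two_mul_m_le N
    omega
  have hμR : 1 / ε ≤ μ := by
    rcases h.n_le_or_le_bound v with hn | hn
    · have h1 : N.n ^ 2 ≤ μ ^ 2 := Nat.pow_le_pow_left hn 2
      have h2 : μ ^ 2 ≤ μ ^ 6 := Nat.pow_le_pow_right (by omega) (by norm_num)
      omega
    · have : (R : ℝ) ≤ μ := by exact_mod_cast (by omega : R ≤ μ)
      linarith
  have hcube : 4 * μ ^ 3 ≤ N.n := by
    by_contra! hc
    have := Nat.pow_lt_pow_left hc two_ne_zero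
    nlinarith
  have hn : N.n ≤ 2 * N.m := by
    have := n_le_m_add_one N
    omega
  have hcard : {q : Dart N | PoorDart s (Nat.clog 2 (4 * N.m)) q}.ncard ≤ μ * μ := by
    have hsub : {q : Dart N | PoorDart s (Nat.clog 2 (4 * N.m)) q} =
        ((S.sigma fun v => (Finset.univ : Finset (Fin (N.deg v)))) : Finset (Dart N)) := by
      ext q
      simp [PoorDart, hS]
    rw [hsub, Set.ncard_coe_finset, Finset.card_sigma]
    calc ∑ w ∈ S, (Finset.univ : Finset (Fin (N.deg w))).card ≤ ∑ _w ∈ S, μ :=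
          Finset.sum_le_sum fun w hw => by
            rw [Finset.card_fin]
            exact ((h.deg_le hR0 w).trans (hmax w hw)).trans (Nat.le_succ _)
      _ = S.card * μ := by simp
      _ ≤ μ * μ := Nat.mul_le_mul_right _
          (card_le_of_id_le S fun w hw => (h.id_le w).trans (hmax w hw))
  have hεμ : 1 ≤ ε * μ := by
    rw [div_le_iff₀ hε] at hμR
    linarith
  have h4 : (4 * (μ : ℝ) ^ 3) ≤ 2 * N.m := by exact_mod_cast hcube.trans hn
  calc ({q : Dart N | PoorDart s (Nat.clog 2 (4 * N.m)) q}.ncard : ℝ) ≤ μ * μ := by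
        exact_mod_cast hcard
    _ ≤ (μ * μ) * (ε * μ) := le_mul_of_one_le_right (by positivity) hεμ
    _ = ε * μ ^ 3 := by ring
    _ ≤ ε * N.m / 2 := by nlinarith

/-! ### Counting coin tosses -/

/-- Prescribing the outcome of the coins in `S` divides the number of outcomes by
`2 ^ S.card`. -/
theorem card_cylinder {V : Type*} [Fintype V] [DecidableEq V] (c : V → ℕ) (g : V → ℕ → Bool)
    (S : Finset (V × ℕ)) (hS : ∀ a ∈ S, a.2 < c a.1) :
    ({r : (v : V) → Fin (c v) → Bool | ∀ a ∈ S, extend (r a.1) a.2 = g a.1 a.2}.ncard : ℝ) =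
      Fintype.card ((v : V) → Fin (c v) → Bool) / 2 ^ S.card := by
  have hset : {r : (v : V) → Fin (c v) → Bool | ∀ a ∈ S, extend (r a.1) a.2 = g a.1 a.2} =
      (Fintype.piFinset fun v => Fintype.piFinset fun j : Fin (c v) =>
        if (v, (j : ℕ)) ∈ S then {g v j} else Finset.univ : Finset _) := by
    ext r
    simp only [Set.mem_ofPred_eq, Finset.mem_coe, Fintype.mem_piFinset]
    constructor
    · intro h v j
      split_ifs with hvj
      · simpa [extend] using h _ hvj
      · exact Finset.mem_univ _
    · rintro h ⟨v, x⟩ ha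
      have := h v ⟨x, hS _ ha⟩
      rw [if_pos ha] at this
      simpa [extend, hS _ ha] using this
  have hcard : S.card =
      (Finset.univ.filter fun p : Σ v, Fin (c v) => (p.1, (p.2 : ℕ)) ∈ S).card := by
    symm
    refine Finset.card_bij (fun p _ => (p.1, (p.2 : ℕ))) (fun p hp => by simpa using hp) ?_ ?_
    · rintro ⟨v, i⟩ _ ⟨w, j⟩ _ h
      obtain ⟨h1, h2⟩ := Prod.mk.inj h
      dsimp only at h1 h2
      subst h1
      rw [Fin.ext h2]
    · rintro ⟨v, x⟩ ha
      exact ⟨⟨v, ⟨x, hS _ ha⟩⟩, by simpa using ha, rfl⟩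
  have hpow : 2 ^ S.card = ∏ v, ∏ j : Fin (c v), if (v, (j : ℕ)) ∈ S then 2 else 1 := by
    rw [← Fintype.prod_sigma' (f := fun v (j : Fin (c v)) => if (v, (j : ℕ)) ∈ S then 2 else 1),
      Finset.prod_ite, hcard]
    simp
  have hmul : {r : (v : V) → Fin (c v) → Bool | ∀ a ∈ S, extend (r a.1) a.2 = g a.1 a.2}.ncard *
      2 ^ S.card = Fintype.card ((v : V) → Fin (c v) → Bool) := by
    rw [hset, Set.ncard_coe_finset, Fintype.card_piFinset, hpow, ← Finset.prod_mul_distrib,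
      Fintype.card_pi]
    refine Finset.prod_congr rfl fun v _ => ?_
    rw [Fintype.card_piFinset, ← Finset.prod_mul_distrib, Fintype.card_pi]
    refine Finset.prod_congr rfl fun j _ => ?_
    split_ifs <;> simp
  rw [eq_div_iff (by positivity)]
  exact_mod_cast hmul

/-- The coins that give the nodes `f 0, …, f (k - 1)` their colors. -/
def colorCells {N : Network} (k : ℕ) (f : ℕ → N.V) : Finset (N.V × ℕ) :=
  (Finset.range k ×ˢ Finset.range k).image fun a => (f a.1, a.2)

/-- The coins that decide whether the level of a link is at least `L`. -/
def levelCells {N : Network} (k L : ℕ) (s : N.V → NodeState) (q : Dart N) : Finset (N.V × ℕ) :=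
  (Finset.range L).image fun j => (q.1, k + q.2 * precision (s q.1).bound + j)

theorem card_colorCells {N : Network} {k : ℕ} {f : ℕ → N.V} (hf : Set.InjOn f (Set.Iio k)) :
    (colorCells k f).card = k * k := by
  rw [colorCells, Finset.card_image_of_injOn, Finset.card_product, Finset.card_range]
  rintro ⟨a, x⟩ ha ⟨b, y⟩ hb h
  simp only [Finset.coe_product, Finset.coe_range, Set.mem_prod, Set.mem_Iio] at ha hb
  obtain ⟨h1, h2⟩ := Prod.mk.inj h
  exact Prod.ext (hf ha.1 hb.1 h1) h2

theorem card_levelCells {N : Network} (k L : ℕ) (s : N.V → NodeState) (q : Dart N) :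
    (levelCells k L s q).card = L := by
  rw [levelCells, Finset.card_image_of_injective, Finset.card_range]
  intro i j h
  simpa using h

theorem disjoint_colorCells_levelCells {N : Network} (k L : ℕ) (s : N.V → NodeState)
    (f : ℕ → N.V) (q : Dart N) : Disjoint (colorCells k f) (levelCells k L s q) := by
  rw [Finset.disjoint_left]
  rintro ⟨v, x⟩ h1 h2
  simp only [colorCells, levelCells, Finset.mem_image, Finset.mem_product, Finset.mem_range,
    Prod.mk.injEq] at h1 h2
  obtain ⟨a, ha, -, h1⟩ := h1
  obtain ⟨j, -, -, h2⟩ := h2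
  have := ha.2
  omega

theorem disjoint_levelCells {N : Network} {k L : ℕ} {s : N.V → NodeState} {q q' : Dart N}
    (hq : L ≤ precision (s q.1).bound) (hne : q' ≠ q) :
    Disjoint (levelCells k L s q) (levelCells k L s q') := by
  rw [Finset.disjoint_left]
  rintro ⟨v, x⟩ h1 h2
  simp only [levelCells, Finset.mem_image, Finset.mem_range, Prod.mk.injEq] at h1 h2
  obtain ⟨j, hj, rfl, rfl⟩ := h1
  obtain ⟨j', hj', hv, h⟩ := h2
  obtain ⟨v, i⟩ := q
  obtain ⟨v', i'⟩ := q'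
  dsimp only at hv h hq
  subst hv
  have hp : 0 < precision (s v').bound := by omega
  have h' : j' + i' * precision (s v').bound = j + i * precision (s v').bound := by omega
  have := congrArg (· / precision (s v').bound) h'
  simp only [Nat.add_mul_div_right _ _ hp, Nat.div_eq_of_lt (hj.trans_le hq),
    Nat.div_eq_of_lt (hj'.trans_le hq), zero_add] at this
  exact hne (by rw [Fin.ext this])

section Phase

variable {k R : ℕ} {N : Network} {s : N.V → NodeState}

theorem tosses_eq (h : Informed R N s) {v : N.V} (hs : PhaseStart k R (s v).clock) :
    tosses k R (s v) = k + N.deg v * precision (s v).bound := by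
  rw [tosses, if_pos hs, h.degree]

theorem lt_tosses_of_mem_levelCells (h : Informed R N s) (hs : ∀ v, PhaseStart k R (s v).clock)
    {L : ℕ} {q : Dart N} (hq : L ≤ precision (s q.1).bound) {a : N.V × ℕ}
    (ha : a ∈ levelCells k L s q) : a.2 < tosses k R (s a.1) := by
  simp only [levelCells, Finset.mem_image, Finset.mem_range] at ha
  obtain ⟨j, hj, rfl⟩ := ha
  rw [tosses_eq h (hs _)]
  have h1 : (q.2 + 1) * precision (s q.1).bound ≤ N.deg q.1 * precision (s q.1).bound :=
    Nat.mul_le_mul_right _ q.2.2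
  rw [add_mul, one_mul] at h1
  dsimp only
  omega

theorem le_level_iff {L : ℕ} {q : Dart N} (hq : L ≤ precision (s q.1).bound)
    (r : Coins k R N s) :
    L ≤ (drawn r q.1).level q.2 ↔ ∀ a ∈ levelCells k L s q, extend (r a.1) a.2 = true := by
  rw [show (drawn r q.1).level q.2 = leadingTrues (extend (r q.1))
    (k + q.2 * precision (s q.1).bound) (precision (s q.1).bound) from rfl,
    le_leadingTrues_iff hq]
  simp [levelCells]

/-- The outcomes of the coins for which the nodes `f 0, …, f (k - 1)` get the colors
`0, …, k - 1`, and `q` is the only link whose level is at least `L`. -/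
def Winning (k R L : ℕ) (N : Network) (s : N.V → NodeState) (f : ℕ → N.V) (q : Dart N) :
    Set (Coins k R N s) :=
  {r | (∀ j < k, (drawn r (f j)).color = j) ∧ L ≤ (drawn r q.1).level q.2 ∧
    ∀ q' : Dart N, L ≤ (drawn r q'.1).level q'.2 → q' = q}

/-- A given link has a level of at least `L`, with given colors on a given cycle, with probability
`2 ^ -(k * k + L)`. As `2 ^ L` is at least twice the number of links, the other links interfere
with conditional probability at most `1 / 2`. -/
theorem le_ncard_winning (h : Informed R N s) (hs : ∀ v, PhaseStart k R (s v).clock) {L : ℕ}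
    (hL : 4 * N.m ≤ 2 ^ L) {q : Dart N} (hq : L ≤ precision (s q.1).bound) {f : ℕ → N.V}
    (hf : Set.InjOn f (Set.Iio k)) :
    (Fintype.card (Coins k R N s) : ℝ) / 2 ^ (k * k + L + 1) ≤
      ((Winning k R L N s f q).ncard : ℝ) := by
  classical
  set tot := ((Fintype.card (Coins k R N s) : ℕ) : ℝ) with htot
  have hcell : ∀ a ∈ colorCells k f, a.2 < k := by
    simp only [colorCells, Finset.mem_image, Finset.mem_product, Finset.mem_range]
    rintro _ ⟨a, ha, rfl⟩
    exact ha.2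
  have hcell' : ∀ (q : Dart N), ∀ a ∈ levelCells k L s q, ¬ a.2 < k := by
    simp only [levelCells, Finset.mem_image, Finset.mem_range]
    rintro q _ ⟨j, hj, rfl⟩
    dsimp only
    omega
  -- The outcomes that the coins shall have: those for the color `j` are `j` times `true`, then
  -- `false`.
  have : Nonempty ℕ := ⟨0⟩
  set idx : N.V → ℕ := Function.invFunOn f (Set.Iio k) with hidx
  have hidx' : ∀ j < k, idx (f j) = j := fun j hj => hf.leftInvOn_invFunOn hj
  set g : N.V → ℕ → Bool := fun v x => if x < k then decide (x < idx v) else true with hg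
  set cyl : Finset (N.V × ℕ) → Set (Coins k R N s) := fun S =>
    {r | ∀ a ∈ S, extend (r a.1) a.2 = g a.1 a.2} with hcyl
  have hlevel : ∀ (q : Dart N), L ≤ precision (s q.1).bound → ∀ r : Coins k R N s,
      L ≤ (drawn r q.1).level q.2 ↔ r ∈ cyl (levelCells k L s q) := by
    intro q hq r
    rw [le_level_iff hq]
    refine forall₂_congr fun a ha => ?_
    simp [hg, hcell' q a ha]
  have hcolor : ∀ r ∈ cyl (colorCells k f), ∀ j < k, (drawn r (f j)).color = j := by
    intro r hr j hj
    refine leadingTrues_eq hj fun x hx => ?_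
    have := hr (f j, x) (by
      simp only [colorCells, Finset.mem_image, Finset.mem_product, Finset.mem_range]
      exact ⟨(j, x), ⟨hj, hx⟩, rfl⟩)
    simpa [hg, hx, hidx' j hj] using this
  have htossC : ∀ a ∈ colorCells k f, a.2 < tosses k R (s a.1) := fun a ha => by
    rw [tosses_eq h (hs _)]
    exact (hcell a ha).trans_le (Nat.le_add_right _ _)
  set S := colorCells k f ∪ levelCells k L s q with hSdef
  have hScard : S.card = k * k + L := by
    rw [hSdef, Finset.card_union_of_disjoint (disjoint_colorCells_levelCells k L s f q),
      card_colorCells hf, card_levelCells]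
  have hS : ((cyl S).ncard : ℝ) = tot / 2 ^ (k * k + L) := by
    rw [← hScard]
    refine card_cylinder _ g S fun a ha => ?_
    rcases Finset.mem_union.1 ha with ha | ha
    · exact htossC a ha
    · exact lt_tosses_of_mem_levelCells h hs hq ha
  set others : Finset (Dart N) :=
    Finset.univ.filter fun q' => q' ≠ q ∧ L ≤ precision (s q'.1).bound with hothers
  have hT : ∀ q' ∈ others,
      ((cyl (S ∪ levelCells k L s q')).ncard : ℝ) = tot / 2 ^ (k * k + L + L) := by
    intro q' hq'
    obtain ⟨hne, hq'⟩ := (Finset.mem_filter.1 hq').2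
    have hcard : (S ∪ levelCells k L s q').card = k * k + L + L := by
      rw [Finset.card_union_of_disjoint, hScard, card_levelCells]
      exact Finset.disjoint_union_left.2
        ⟨disjoint_colorCells_levelCells k L s f q', disjoint_levelCells hq hne⟩
    rw [← hcard]
    refine card_cylinder _ g _ fun a ha => ?_
    simp only [hSdef, Finset.mem_union] at ha
    rcases ha with (ha | ha) | ha
    · exact htossC a ha
    · exact lt_tosses_of_mem_levelCells h hs hq ha
    · exact lt_tosses_of_mem_levelCells h hs hq' ha
  have hcover : cyl S ⊆ Winning k R L N s f q ∪
      ⋃ q' ∈ others, cyl (S ∪ levelCells k L s q') := by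
    intro r hr
    by_cases hex : ∃ q' ∈ others, L ≤ (drawn r q'.1).level q'.2
    · obtain ⟨q', hq', hle⟩ := hex
      refine Or.inr (Set.mem_biUnion hq' fun a ha => ?_)
      rcases Finset.mem_union.1 ha with ha | ha
      · exact hr a ha
      · exact (hlevel q' (Finset.mem_filter.1 hq').2.2 r).1 hle a ha
    · refine Or.inl ⟨hcolor r fun a ha => hr a (Finset.mem_union_left _ ha),
        (hlevel q hq r).2 fun a ha => hr a (Finset.mem_union_right _ ha), fun q' hle => ?_⟩
      by_contra hne
      refine hex ⟨q', ?_, hle⟩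
      simp only [hothers, Finset.mem_filter, Finset.mem_univ, true_and]
      exact ⟨hne, hle.trans (leadingTrues_le _ _ _)⟩
  have hsum : ((cyl S).ncard : ℝ) ≤ (Winning k R L N s f q).ncard +
      ∑ q' ∈ others, ((cyl (S ∪ levelCells k L s q')).ncard : ℝ) := by
    have h1 := (Set.ncard_le_ncard hcover (Set.toFinite _)).trans (Set.ncard_union_le _ _)
    have h2 : (⋃ q' ∈ others, cyl (S ∪ levelCells k L s q')).ncard ≤
        ∑ q' ∈ others, (cyl (S ∪ levelCells k L s q')).ncard :=
      Finset.set_ncard_biUnion_le _ _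
    exact_mod_cast h1.trans (Nat.add_le_add_left h2 _)
  rw [hS, Finset.sum_congr rfl hT, Finset.sum_const, nsmul_eq_mul] at hsum
  have hcount : (others.card : ℝ) ≤ 2 ^ L / 2 := by
    have h1 : others.card ≤ 2 * N.m := by
      rw [← card_dart]
      exact Finset.card_le_univ _
    have h2 : ((others.card * 2 : ℕ) : ℝ) ≤ (2 ^ L : ℕ) := by exact_mod_cast (by omega)
    push_cast at h2
    linarith
  have hloss : (others.card : ℝ) * (tot / 2 ^ (k * k + L + L)) ≤ tot / 2 ^ (k * k + L + 1) := by
    calc (others.card : ℝ) * (tot / 2 ^ (k * k + L + L)) ≤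
          2 ^ L / 2 * (tot / 2 ^ (k * k + L + L)) := by gcongr
      _ = tot / 2 ^ (k * k + L + 1) := by
        rw [pow_add _ (k * k + L) L, pow_succ]
        field_simp
  have hhalf : tot / 2 ^ (k * k + L) = 2 * (tot / 2 ^ (k * k + L + 1)) := by
    rw [pow_succ]
    field_simp
  linarith

/-- A lower bound for the probability that some node rejects in a given phase, in a network that is
`ε`-far from `C_k`-free. -/
noncomputable def detection (k : ℕ) (ε : ℝ) : ℝ := ε / 2 ^ (k * k + 5)

/-- In a network that is far from `C_k`-free, at most the given proportion of the outcomes of the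
coins of a phase leads to no rejection. The events that the different good links win are disjoint;
there are at least `ε * m / 2` good links that are not poor, and each of them wins with
probability at least `2 ^ -(k * k) / (16 * m)`. -/
theorem ncard_no_rejection_le (hk : 3 ≤ k) {ε : ℝ} (hε : 0 < ε) (hR : 1 / ε ≤ R)
    (h : Informed R N s) (hs : ∀ v, PhaseStart k R (s v).clock) (hfar : N.FarFromCycleFree k ε) :
    ({r : Coins k R N s | ∀ v, (phaseState k N (drawn r) k v).rejected = false}.ncard : ℝ) ≤
      (1 - detection k ε) * Fintype.card (Coins k R N s) := by
  classical
  set tot := ((Fintype.card (Coins k R N s) : ℕ) : ℝ) with htot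
  have hgood := lt_ncard_goodDart hk hfar
  have hm : 0 < N.m := by
    by_contra! hm
    have h1 := card_dart N
    have h2 : {q : Dart N | GoodDart N k q}.ncard ≤ 0 := by
      refine (Set.ncard_le_card _).trans ?_
      rw [Nat.card_eq_fintype_card, h1]
      omega
    have h3 : ({q : Dart N | GoodDart N k q}.ncard : ℝ) ≤ 0 := by exact_mod_cast h2
    have h4 : (0 : ℝ) ≤ ε * N.m := by positivity
    linarith
  set L := Nat.clog 2 (4 * N.m) with hL
  have hpoor := ncard_poorDart_le hε hR h hm
  rw [← hL] at hpoor
  set W : Finset (Dart N) := Finset.univ.filter fun q => GoodDart N k q ∧ ¬ PoorDart s L q with hW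
  have hWcard : ε * N.m / 2 ≤ (W.card : ℝ) := by
    have hsub : {q | GoodDart N k q} ⊆ (W : Set (Dart N)) ∪ {q | PoorDart s L q} := by
      intro q hq
      by_cases hp : PoorDart s L q
      · exact Or.inr hp
      · exact Or.inl (by simpa [hW] using ⟨hq, hp⟩)
    have h1 := (Set.ncard_le_ncard hsub (Set.toFinite _)).trans (Set.ncard_union_le _ _)
    rw [Set.ncard_coe_finset] at h1
    have h2 : ({q : Dart N | GoodDart N k q}.ncard : ℝ) ≤
        W.card + ({q : Dart N | PoorDart s L q}.ncard : ℝ) := by exact_mod_cast h1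
    linarith
  have hcycle : ∀ q : Dart N, ∃ f, q ∈ W → IsCycleFrom N k q f := fun q => by
    by_cases hq : q ∈ W
    · obtain ⟨f, hf⟩ := (Finset.mem_filter.1 hq).2.1
      exact ⟨f, fun _ => hf⟩
    · exact ⟨fun _ => q.1, fun h => absurd h hq⟩
  choose f hf using hcycle
  set E : Dart N → Set (Coins k R N s) := fun q => Winning k R L N s (f q) q with hE
  have hdisj : (W : Set (Dart N)).PairwiseDisjoint E := by
    intro q _ q' _ hne
    refine Set.disjoint_left.2 fun r hr hr' => hne ?_
    exact hr'.2.2 q hr.2.1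
  have hrej : ∀ q ∈ W, ∀ r ∈ E q, ∃ v, (phaseState k N (drawn r) k v).rejected = true := by
    rintro ⟨v, i⟩ hq r hr
    obtain ⟨-, hstart, hsecond, hadj, hlast⟩ := hf _ hq
    obtain ⟨hcol, hlev, huniq⟩ := hr
    generalize f ⟨v, i⟩ = φ at *
    dsimp only at hstart hsecond hlev
    subst hstart
    exact ⟨φ 0, rejected_of_unique_level (by omega) hcol hadj hlast hsecond hlev
      fun w j hw => congrArg Sigma.fst (huniq ⟨w, j⟩ hw)⟩
  have hlow : ε / 2 ^ (k * k + 5) * tot ≤ ((⋃ q ∈ W, E q).ncard : ℝ) := by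
    have h1 : (⋃ q ∈ W, E q).ncard = ∑ q ∈ W, (E q).ncard := by
      have := W.finite_toSet.ncard_biUnion (s := E) (fun _ _ => Set.toFinite _) hdisj
      rwa [finsum_mem_coe_finset] at this
    rw [h1]
    push_cast
    have h2 : ∀ q ∈ W, tot / 2 ^ (k * k + L + 1) ≤ ((E q).ncard : ℝ) := fun q hq =>
      le_ncard_winning h hs (Nat.le_pow_clog (by norm_num) _)
        (not_lt.1 (Finset.mem_filter.1 hq).2.2) (hf q hq).injOn
    refine le_trans ?_ (Finset.sum_le_sum h2)
    rw [Finset.sum_const, nsmul_eq_mul]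
    have hL8 : (2 : ℝ) ^ L ≤ 8 * N.m := by
      have h3 : 2 ^ (L - 1) < 4 * N.m := Nat.pow_pred_clog_lt_self (by norm_num) (by omega)
      have h4 : 0 < L := Nat.clog_pos (by norm_num) (by omega)
      have h5 : 2 ^ L = 2 * 2 ^ (L - 1) := by rw [← pow_succ', Nat.sub_add_cancel h4]
      exact_mod_cast (by omega : 2 ^ L ≤ 8 * N.m)
    have hmR : (0 : ℝ) < N.m := by exact_mod_cast hm
    calc ε / 2 ^ (k * k + 5) * tot = ε * N.m / 2 * (tot / (2 ^ (k * k) * (8 * N.m) * 2)) := by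
          rw [pow_add]
          field_simp
          ring
      _ ≤ W.card * (tot / (2 ^ (k * k) * 2 ^ L * 2)) := by gcongr
      _ = W.card * (tot / 2 ^ (k * k + L + 1)) := by rw [pow_succ, pow_add]
  have hsub : {r : Coins k R N s | ∀ v, (phaseState k N (drawn r) k v).rejected = false} ⊆
      (⋃ q ∈ W, E q)ᶜ := by
    intro r hr hmem
    obtain ⟨q, hq, hmem⟩ := Set.mem_iUnion₂.1 hmem
    obtain ⟨v, hv⟩ := hrej q hq r hmem
    simp [hr v] at hv
  have h1 := Set.ncard_le_ncard hsub (Set.toFinite _)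
  have h2 := Set.ncard_add_ncard_compl (⋃ q ∈ W, E q)
  rw [Nat.card_eq_fintype_card] at h2
  have h3 : (((⋃ q ∈ W, E q).ncard : ℝ)) + ((⋃ q ∈ W, E q)ᶜ.ncard : ℝ) = tot := by
    rw [htot]
    exact_mod_cast h2
  have h4 : ({r : Coins k R N s | ∀ v, (phaseState k N (drawn r) k v).rejected = false}.ncard : ℝ)
      ≤ ((⋃ q ∈ W, E q)ᶜ.ncard : ℝ) := by exact_mod_cast h1
  rw [detection, sub_mul, one_mul]
  linarith

end Phase

/-! ### The outcome of all phases -/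

section Outcome

variable {k R T : ℕ} {N : Network}

theorem detection_le_one (k : ℕ) {ε : ℝ} (hε : ε ≤ 1) : detection k ε ≤ 1 := by
  unfold detection
  rw [div_le_one (by positivity)]
  exact hε.trans (one_le_pow₀ (by norm_num))

theorem afterRounds_phase_succ (j : ℕ) :
    (tester k R T).afterRounds N (R + k * (j + 1)) =
      ((tester k R T).afterRounds N (R + k * j)).bind fun s => advance (tester k R T) N s k := by
  rw [mul_add, mul_one, ← add_assoc, afterRounds_add]

theorem advance_eq (hk : 0 < k) {j : ℕ} {s : N.V → NodeState}
    (hs : ∀ v, (s v).clock = R + k * j) :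
    advance (tester k R T) N s k =
      (PMF.uniformOfFintype (Coins k R N s)).map fun r => phaseState k N (drawn r) k := by
  obtain ⟨m, rfl⟩ : ∃ m, k = m + 1 := ⟨k - 1, by omega⟩
  exact advance_phase hs (Nat.lt_succ_self m)

theorem clock_eq {t : ℕ} {s : (tester k R T).Config N}
    (hs : s ∈ ((tester k R T).afterRounds N t).support) (v : N.V) : (s v).clock = t :=
  (afterRounds_clock_and_reach hs v).1

theorem not_rejected_of_le {t : ℕ} (ht : t ≤ R) {s : (tester k R T).Config N}
    (hs : s ∈ ((tester k R T).afterRounds N t).support) (v : N.V) : (s v).rejected = false := by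
  refine (afterRounds_induction (A := tester k R T) (P := fun t s => ∀ v : N.V,
    (s v).clock = t ∧ (t ≤ R → (s v).rejected = false)) (fun v => ⟨rfl, fun _ => rfl⟩) ?_
    t hs v).2 ht
  intro t s h r v
  set s' : (tester k R T).Config N := fun v => (tester k R T).compute (s v) (r v) with hs'
  have hc : ∀ v, (s' v).clock = t := fun v => (compute_clock (s v) (r v)).trans (h v).1
  refine ⟨(communicate_clock s' v).trans (congrArg (· + 1) (hc v)), fun ht => ?_⟩
  have h1 : ((tester k R T).communicate N s' v).rejected = (s' v).rejected := by
    have : t < R := ht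
    simp only [Algorithm.communicate, tester, hc, this, if_true]
  rw [h1]
  exact (compute_rejected (s v) (r v)).trans ((h v).2 (by omega))

theorem not_rejected_of_cycleFree (hk : 3 ≤ k) (hR : 0 < R) (hfree : N.CycleFree k) (j : ℕ)
    {s : (tester k R T).Config N}
    (hs : s ∈ ((tester k R T).afterRounds N (R + k * j)).support) (v : N.V) :
    (s v).rejected = false := by
  induction j generalizing s v with
  | zero => exact not_rejected_of_le le_rfl hs v
  | succ j ih =>
    rw [afterRounds_phase_succ, PMF.mem_support_bind_iff] at hs
    obtain ⟨s', hs', hs⟩ := hs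
    rw [advance_eq (by omega) (clock_eq hs')] at hs
    obtain ⟨r, -, rfl⟩ := (PMF.mem_support_map_iff _ _ _).1 hs
    by_contra hr
    exact not_cycleFree_of_rejected hk (s := drawn r)
      (fun w => (informed_afterRounds hR (Nat.le_add_right _ _) hs').ident w)
      (Bool.not_eq_false _ ▸ hr : (phaseState k N (drawn r) k v).rejected = true) (ih hs' v) hfree

theorem advance_phase_toOuterMeasure_le (hk : 3 ≤ k) {ε : ℝ} (hε : 0 < ε) (hε1 : ε < 1)
    (hR : 1 / ε ≤ R) (hfar : N.FarFromCycleFree k ε) {j : ℕ} {s : N.V → NodeState}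
    (hs : ∀ v, (s v).clock = R + k * j) (h : Informed R N s) :
    (advance (tester k R T) N s k).toOuterMeasure {s' | ∀ v, (s' v).rejected = false} ≤
      ENNReal.ofReal (1 - detection k ε) := by
  classical
  rw [advance_eq (by omega) hs]
  refine (PMF.toOuterMeasure_map_apply (fun r : Coins k R N s => phaseState k N (drawn r) k)
    (PMF.uniformOfFintype (Coins k R N s)) {s' | ∀ v, (s' v).rejected = false}).trans_le ?_
  have hstart : ∀ v, PhaseStart k R (s v).clock := fun v => by
    rw [hs]
    exact ⟨by omega, by simp⟩
  have hcount := ncard_no_rejection_le hk hε hR h hstart hfar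
  rw [PMF.toOuterMeasure_uniformOfFintype_apply]
  refine ENNReal.div_le_of_le_mul ?_
  rw [← Nat.card_eq_fintype_card, ← ENNReal.ofReal_natCast, ← ENNReal.ofReal_natCast,
    ← ENNReal.ofReal_mul (sub_nonneg.2 (detection_le_one k hε1.le))]
  exact ENNReal.ofReal_le_ofReal hcount

/-- Rejections are never withdrawn. -/
theorem advance_phase_toOuterMeasure_eq_zero (hk : 0 < k) {j : ℕ} {s : N.V → NodeState}
    (hs : ∀ v, (s v).clock = R + k * j) {v : N.V} (hv : (s v).rejected = true) :
    (advance (tester k R T) N s k).toOuterMeasure {s' | ∀ v, (s' v).rejected = false} = 0 := by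
  rw [advance_eq hk hs]
  refine (PMF.toOuterMeasure_apply_eq_zero_iff _ _).2 (Set.disjoint_left.2 fun s' hs' hno => ?_)
  obtain ⟨r, -, rfl⟩ := (PMF.mem_support_map_iff _ _ _).1 hs'
  have hr : (phaseState k N (drawn r) k v).rejected = true := phaseState_rejected_mono hv
  exact Bool.false_ne_true ((hno v).symm.trans hr)

/-- Every phase reduces the probability that no node has rejected yet by a constant factor. -/
theorem prob_not_rejected_le (hk : 3 ≤ k) {ε : ℝ} (hε : 0 < ε) (hε1 : ε < 1)
    (hR : 1 / ε ≤ R) (hfar : N.FarFromCycleFree k ε) (j : ℕ) :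
    ((tester k R T).afterRounds N (R + k * j)).toOuterMeasure
      {s | ∀ v, (s v).rejected = false} ≤ ENNReal.ofReal (1 - detection k ε) ^ j := by
  have hR0 : 0 < R := by
    have : (0 : ℝ) < R := lt_of_lt_of_le (by positivity) hR
    exact_mod_cast this
  set NR : Set ((tester k R T).Config N) := {s | ∀ v, (s v).rejected = false} with hNR
  induction j with
  | zero =>
    rw [pow_zero, ← (PMF.toOuterMeasure_apply_eq_one_iff _ Set.univ).2 (Set.subset_univ _)]
    exact MeasureTheory.measure_mono (Set.subset_univ _)
  | succ j ih =>
    rw [afterRounds_phase_succ, PMF.toOuterMeasure_bind_apply, pow_succ']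
    set p := (tester k R T).afterRounds N (R + k * j) with hp
    refine le_trans ?_ (mul_le_mul_right ih _)
    rw [PMF.toOuterMeasure_apply, ← ENNReal.tsum_mul_left]
    refine ENNReal.tsum_le_tsum fun s => ?_
    by_cases hs : s ∈ p.support
    · by_cases hno : s ∈ NR
      · rw [Set.indicator_of_mem hno, mul_comm]
        exact mul_le_mul_left (advance_phase_toOuterMeasure_le hk hε hε1 hR hfar (clock_eq hs)
          (informed_afterRounds hR0 (Nat.le_add_right _ _) hs)) _
      · obtain ⟨v, hv⟩ : ∃ v, (s v).rejected = true := by simpa [hNR] using hno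
        rw [Set.indicator_of_notMem hno, mul_zero]
        exact (mul_eq_zero_of_right _
          (advance_phase_toOuterMeasure_eq_zero (by omega) (clock_eq hs) hv)).le
    · simp [(PMF.apply_eq_zero_iff _ _).2 hs]

theorem probAccept_eq_one (hk : 3 ≤ k) (hR : 0 < R) (hfree : N.CycleFree k) :
    (tester k R T).probAccept N = 1 := by
  rw [Algorithm.probAccept, PMF.toOuterMeasure_apply_eq_one_iff]
  intro s hs v
  have := not_rejected_of_cycleFree hk hR hfree T hs v
  simp [tester, this]

theorem two_thirds_le_probReject (hk : 3 ≤ k) {ε : ℝ} (hε : 0 < ε) (hε1 : ε < 1)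
    (hR : 1 / ε ≤ R) (hT : 2 / detection k ε ≤ T) (hfar : N.FarFromCycleFree k ε) :
    2 / 3 ≤ (tester k R T).probReject N := by
  set μ := ((tester k R T).afterRounds N (tester k R T).rounds).toOuterMeasure with hμ
  have hδ : 0 < detection k ε := by unfold detection; positivity
  have hδ1 := detection_le_one k hε1.le
  have hfail : μ {s | ∀ v, (s v).rejected = false} ≤ ENNReal.ofReal (1 / 3) := by
    refine (prob_not_rejected_le hk hε hε1 hR hfar T).trans ?_
    rw [← ENNReal.ofReal_pow (by linarith)]
    refine ENNReal.ofReal_le_ofReal ?_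
    have h1 : 2 ≤ detection k ε * T := by
      rw [div_le_iff₀ hδ] at hT
      linarith
    calc (1 - detection k ε) ^ T ≤ Real.exp (-detection k ε) ^ T :=
          pow_le_pow_left₀ (by linarith) (Real.one_sub_le_exp_neg _) _
      _ = Real.exp (-(detection k ε * T)) := by rw [← Real.exp_nat_mul]; ring_nf
      _ ≤ Real.exp (-2) := Real.exp_le_exp.2 (by linarith)
      _ ≤ 1 / 3 := by
          rw [Real.exp_neg, ← one_div]
          exact one_div_le_one_div_of_le (by norm_num)
            (by linarith [Real.add_one_le_exp (2 : ℝ)])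
  have huniv : (Set.univ : Set ((tester k R T).Config N)) ⊆
      {s | ∃ v, (tester k R T).output (s v) = Verdict.reject} ∪
        {s | ∀ v, (s v).rejected = false} := by
    intro s _
    by_cases h : ∀ v, (s v).rejected = false
    · exact Or.inr h
    · push Not at h
      obtain ⟨v, hv⟩ := h
      exact Or.inl ⟨v, by simpa [tester] using hv⟩
  have hone : (1 : ℝ≥0∞) ≤ (tester k R T).probReject N + ENNReal.ofReal (1 / 3) := by
    rw [← (PMF.toOuterMeasure_apply_eq_one_iff
      ((tester k R T).afterRounds N (tester k R T).rounds) Set.univ).2 (Set.subset_univ _)]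
    exact ((MeasureTheory.measure_mono huniv).trans (MeasureTheory.measure_union_le _ _)).trans
      (add_le_add le_rfl hfail)
  have h23 : (2 / 3 : ℝ≥0∞) = ENNReal.ofReal (2 / 3) := by
    rw [ENNReal.ofReal_div_of_pos (by norm_num)]
    norm_num
  rw [h23, ← ENNReal.add_le_add_iff_right (a := ENNReal.ofReal (1 / 3)) (by simp),
    ← ENNReal.ofReal_add (by norm_num) (by norm_num)]
  norm_num
  simpa using hone

end Outcome

end CycleTester

end Congest

open Congest.CycleTester in
theorem theorem1 (k : ℕ) (hk : 3 ≤ k) :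
    ∃ (K : ℝ) (β : ℕ → ℕ → ℝ), ∀ ε : ℝ, 0 < ε → ε < 1 →
      ∃ A : Congest.Algorithm, (A.rounds : ℝ) ≤ K / ε ∧
        ∀ N : Congest.Network,
          (∀ a b : ℕ, (∀ v, N.id v ≤ a * N.n ^ b) →
            A.MessagesBoundedBy N (β a b * Real.logb 2 N.n)) ∧
          (N.CycleFree k → A.probAccept N = 1) ∧
          (N.FarFromCycleFree k ε → 2 / 3 ≤ A.probReject N) := by
  refine ⟨2 + k * (2 ^ (k * k + 6) + 1), fun a b => 7 * (a.size + 2 * b) + 6, fun ε hε hε1 =>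
    ⟨tester k ⌈1 / ε⌉₊ ⌈2 / detection k ε⌉₊, ?_, fun N =>
      ⟨fun a b hid => messagesBoundedBy k _ _ a b hid, fun hfree => ?_, fun hfar => ?_⟩⟩⟩
  · have h1 : 1 ≤ 1 / ε := by rw [le_div_iff₀ hε]; linarith
    have hR : (⌈1 / ε⌉₊ : ℝ) ≤ 1 / ε + 1 := (Nat.ceil_lt_add_one (by positivity)).le
    have hT : (⌈2 / detection k ε⌉₊ : ℝ) ≤ 2 / detection k ε + 1 := by
      refine (Nat.ceil_lt_add_one ?_).le
      unfold detection
      positivity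
    have hδ : 2 / detection k ε = 2 ^ (k * k + 6) * (1 / ε) := by
      unfold detection
      rw [pow_succ _ (k * k + 5)]
      field_simp
    change ((⌈1 / ε⌉₊ + k * ⌈2 / detection k ε⌉₊ : ℕ) : ℝ) ≤ _
    push_cast
    calc (⌈1 / ε⌉₊ : ℝ) + k * ⌈2 / detection k ε⌉₊ ≤
          (1 / ε + 1 / ε) + k * (2 ^ (k * k + 6) * (1 / ε) + 1 / ε) := by
          rw [hδ] at hT ⊢
          gcongr <;> linarith
      _ = _ := by ring
  · exact probAccept_eq_one hk (Nat.ceil_pos.2 (by positivity)) hfree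
  · exact two_thirds_le_probReject hk hε hε1 (Nat.le_ceil _) (Nat.le_ceil _) hfar
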